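/- **Setting.** A vehicle with configurations in $\mathbb R^2\times S^1$ (location, heading) moves at constant speed $s>0$ with minimum turning radius $r>0$ (Dubins vehicle) at altitude $a>0$, starting at $v_0$. $\mathtt{DIST}(v,w)$ is the minimum time of a Dubins path from $v$ to $w$. There are $M\ge 1$ targets; target $j$ has a location $t_j\in\mathbb R^2$, a behavior in $\{\mathrm{ANY},\mathrm{ANGLE},\mathrm{FULL}\}$, an azimuth interval $[\phi_j^A-\Delta_j^A,\phi_j^A+\Delta_j^A]$, a tilt interval $[\phi_j^T-\Delta_j^T,\phi_j^T+\Delta_j^T]\subset(0,\pi/2]$ and a number $\tau_j\in\mathbb Z_{\ge0}$ of loops. $\mathtt{VIS}_j$ is the closed annulus centered at $t_j$ with radial limits $a/\tan(\phi_j^T\pm\Delta_j^T)$, restricted, if the behavior is ANGLE, to the sector with angular limits $\phi_j^A\pm\Delta_j^A$. If $\tau_j=0$, a dwell maneuver at $j$ consists of being over a point of $\mathtt{VIS}_j$ (and takes no time). If $\tau_j>0$, it consists of $\tau_j$ full loops along a circle contained in $\mathtt{VIS}_j$, which is centered at $t_j$ and has some radius $\rho\ge r$ if the behavior is FULL, and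 otherwise has its center in $\mathtt{VIS}_j$ and radius $r$. $\mathtt{DWL}_j$ is the set of configurations at which a dwell maneuver at $j$ can start. **Problem 1.** For $\varepsilon\ge0$, a feasible tour consists of a Dubins trajectory of duration at most $\varepsilon$ from $v_0$ to the start of a closed trajectory (the initial maneuver), and of that closed Dubins trajectory, along which dwell maneuvers are performed one after the other, in some order, at all targets, beginning with the maneuver at the first target. Minimize the duration of the closed trajectory. **Definitions.** $\mathtt{INL}_\varepsilon=\{v\in\bigcup_j\mathtt{DWL}_j : \mathtt{DIST}(v_0,v)\le\varepsilon\}$. $\mathtt{CLS}_\varepsilon$ is the union over permutations $\sigma$ of $(\mathtt{DWL}_{\sigma(1)}\cap\mathtt{INL}_\varepsilon)\times\mathtt{DWL}_{\sigma(2)}\times\dots\times\mathtt{DWL}_{\sigma(M)}$, whose elements are regarded as labelled by $\sigma$ (the union is disjoint). $\mathtt{LGTH}$ of an element $(v_1,\dots,v_M)$ is the sum of the durations of the dwell maneuvers at $v_k$ for target $\sigma(k)$ and of $\mathtt{DIST}(v_k,v_{k+1})$, with $v_{M+1}=v_1$; $\mathtt{LGTH}^*$ is its infimum. Problem 1 is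 *degenerate* if, for every convergent sequence in $\mathtt{CLS}_\varepsilon$ along which $\mathtt{LGTH}\to\mathtt{LGTH}^*$, the limit $\mathbf v^*$ (with the order $\sigma$ of the sequence, which is eventually constant) satisfies one of the following: (i) $\mathbf v^*\notin\mathtt{CLS}_\varepsilon$; (ii) $\mathtt{LGTH}$ is discontinuous at $\mathbf v^*$; (iii) $v_1^*$ is isolated in $\mathtt{INL}_\varepsilon$; (iv) $v_1^*$ is not a limit of interior points of $\mathtt{INL}_\varepsilon\cap\mathtt{DWL}_{\sigma(1)}$ relative to $\mathtt{DWL}_{\sigma(1)}$. **Algorithm 5.** Given finite samples $A_j\subset\mathtt{DWL}_j$, let $V$ be the set of all pairs $(j,v)$ with $v\in A_j$, with weights $W((j,v),(j',v'))$ equal to the duration of the dwell maneuver of $(j,v)$ plus $\mathtt{DIST}(v,v')$. Let $I=\{(j,v)\in V:\mathtt{DIST}(v_0,v)\le\varepsilon\}$. If $I=\emptyset$, report that the discrete problem is infeasible. Otherwise choose a set $I^*\subseteq I$ of nodes of a single target $\hat\jmath$, delete from $V$ the nodes of $\hat\jmath$ not in $I^*$, find a closed path through exactly one remaining node of each target (a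 solution of the generalized traveling salesperson problem, GTSP), permute it cyclically to $u_1,\dots,u_M$ so that $u_1$ belongs to $\hat\jmath$, connect $v_0,u_1,\dots,u_M,u_1$ by optimal Dubins paths, and insert the dwell maneuvers of $u_1,\dots,u_M$; output the resulting initial maneuver and closed trajectory. **Theorem (Resolution Completeness).** Assume that Problem 1 is not degenerate, that $\mathtt{INL}_\varepsilon\ne\emptyset$, and that there is $\hat\jmath$ with $\mathtt{INL}_\varepsilon\subseteq\mathtt{DWL}_{\hat\jmath}$ or $\mathtt{DWL}_{\hat\jmath}\subseteq\mathtt{INL}_\varepsilon$. (a) Every tour output by Algorithm 5 is feasible for Problem 1. (b) For each $N$ let $A_{j,N}\subset\mathtt{DWL}_j$ be samples with $|A_{j,N}|=N$ that are dense: for every $x\in\mathtt{DWL}_j$ and every open neighborhood $U$ of $x$, $A_{j,N}\cap U\neq\emptyset$ for all large $N$. Consider a sequence of results of Algorithm 5 on these samples in which the GTSP is solved to optimality and in which, whenever $I\ne\emptyset$, the target $\hat\jmath$ is such that all nodes in $I$ belong to $\hat\jmath$ or all nodes of $\hat\jmath$ are in $I$, and $I^*$ is the set of all nodes of $\hat\jmath$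 in $I$. Then, for all large $N$, the algorithm outputs a tour; Problem 1 has an optimal solution; and the durations of the closed trajectories output converge to the optimal duration as $N\to\infty$. -/

import Mathlib

open Filter Topology

noncomputable section

/-- UAV configurations (location, heading). The plane is `ℂ` with its Euclidean norm and the
heading is a point of the unit circle `S¹`. -/
abbrev Config : Type := ℂ × Circle

/-- Required viewing behaviour of a target. -/
inductive Behavior : Type
  | any
  | angle
  | full

/-- The data of a mission with `M` targets: altitude `a`, speed `s`, minimum turning radius `r`,
bound `ε` on the initial maneuver time, initial configuration `v₀`, and for every target its
location, viewing behaviour, azimuth interval `[φA - ΔA, φA + ΔA]`, tilt interval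
`[φT - ΔT, φT + ΔT] ⊆ (0, π/2]`, and number `τ` of dwell-time loops. -/
structure Mission (M : ℕ) where
  a : ℝ
  s : ℝ
  r : ℝ
  ε : ℝ
  v₀ : Config
  loc : Fin M → ℂ
  beh : Fin M → Behavior
  φA : Fin M → ℝ
  ΔA : Fin M → ℝ
  φT : Fin M → ℝ
  ΔT : Fin M → ℝ
  τ : Fin M → ℕ
  a_pos : 0 < a
  s_pos : 0 < s
  r_pos : 0 < r
  ε_nonneg : 0 ≤ ε
  ΔA_nonneg : ∀ j, 0 ≤ ΔA j
  ΔT_nonneg : ∀ j, 0 ≤ ΔT j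
  tilt_pos : ∀ j, 0 < φT j - ΔT j
  tilt_le : ∀ j, φT j + ΔT j ≤ Real.pi / 2

/-- A UAV tour: an initial maneuver, traversed during `[0, initTime]`, and a closed trajectory,
traversed during `[0, closedTime]`. Values outside these intervals are irrelevant. -/
structure Tour where
  initTime : ℝ
  init : ℝ → Config
  closedTime : ℝ
  closed : ℝ → Config

namespace Mission

variable {M : ℕ} (P : Mission M)

/-- Visibility region of target `j`: the annulus, or annular sector if the behaviour is `angle`,
centred at the target with radial limits `a / tan (φT ± ΔT)` and angular limits `φA ± ΔA`.
(At the tilt `π / 2` Lean evaluates `a / tan (π / 2)` to the intended value `0`.) -/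
def vis (j : Fin M) : Set ℂ :=
  {x | ∃ ρ α : ℝ, P.a / Real.tan (P.φT j + P.ΔT j) ≤ ρ ∧ ρ ≤ P.a / Real.tan (P.φT j - P.ΔT j) ∧
    (P.beh j = Behavior.angle → P.φA j - P.ΔA j ≤ α ∧ α ≤ P.φA j + P.ΔA j) ∧
    x = P.loc j + ρ * Complex.exp (α * Complex.I)}

/-- The circle with centre `c` and radius `ρ` is admissible for the (non-trivial) dwell-time loops
at target `j`: for `full`, it is centred at the target and its radius is flyable; otherwise, its
centre is a pivot point in the visibility region and its radius is `r`. In both cases it lies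
entirely within the visibility region. -/
def IsDwellCircle (j : Fin M) (c : ℂ) (ρ : ℝ) : Prop :=
  (P.beh j = Behavior.full → c = P.loc j ∧ P.r ≤ ρ) ∧
  (P.beh j ≠ Behavior.full → c ∈ P.vis j ∧ ρ = P.r) ∧
  Metric.sphere c ρ ⊆ P.vis j

/-- `DWL_j`: the configurations at which a dwell-time maneuver at target `j` can start. -/
def dwl (j : Fin M) : Set Config :=
  {v | (P.τ j = 0 → v.1 ∈ P.vis j) ∧
    (P.τ j ≠ 0 → ∃ (c : ℂ) (ρ : ℝ), P.IsDwellCircle j c ρ ∧ v.1 ∈ Metric.sphere c ρ ∧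
      inner ℝ (v.1 - c) (v.2 : ℂ) = 0)}

/-- The time needed for the dwell-time maneuver at target `j` that starts in `v ∈ DWL_j`
(`τ j` loops, about the target itself for `full`, and of radius `r` otherwise). -/
def dwellTime (j : Fin M) (v : Config) : ℝ :=
  match P.beh j with
  | Behavior.full => P.τ j * (2 * Real.pi * ‖v.1 - P.loc j‖) / P.s
  | _ => P.τ j * (2 * Real.pi * P.r) / P.s

/-- `γ` is, on `[t₀, t₁]`, a trajectory of the Dubins vehicle: it moves with speed `s` in the
direction of its heading, whose angle `Θ` changes at rate at most `s / r`. -/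
def IsDubinsOn (γ : ℝ → Config) (t₀ t₁ : ℝ) : Prop :=
  ∃ Θ : ℝ → ℝ,
    (∀ t ∈ Set.Icc t₀ t₁, ∀ t' ∈ Set.Icc t₀ t₁, |Θ t - Θ t'| ≤ P.s / P.r * |t - t'|) ∧
    ∀ t ∈ Set.Icc t₀ t₁, (γ t).2 = Circle.exp (Θ t) ∧
      HasDerivWithinAt (fun t' => (γ t').1) (P.s * ((γ t).2 : ℂ)) (Set.Icc t₀ t₁) t

/-- `DIST(v, w)`: the minimum time of a Dubins path from `v` to `w`. -/
def dubinsDist (v w : Config) : ℝ :=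
  sInf {T : ℝ | 0 ≤ T ∧ ∃ γ : ℝ → Config, P.IsDubinsOn γ 0 T ∧ γ 0 = v ∧ γ T = w}

/-- `γ` is, on `[t₀, t₁]`, an optimal Dubins path from `v` to `w`. -/
def IsOptimalPath (γ : ℝ → Config) (t₀ t₁ : ℝ) (v w : Config) : Prop :=
  t₀ ≤ t₁ ∧ P.IsDubinsOn γ t₀ t₁ ∧ γ t₀ = v ∧ γ t₁ = w ∧ t₁ - t₀ = P.dubinsDist v w

/-- `γ` performs, during `[t₀, t₁]`, a dwell-time maneuver at target `j`: if `τ j = 0`, the vehicle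
is over the visibility region at time `t₀ = t₁`; otherwise it flies, with speed `s`, exactly `τ j`
full loops (counter-clockwise if `o = 1` and clockwise if `o = -1`) along an admissible circle. -/
def IsDwellManeuver (j : Fin M) (γ : ℝ → Config) (t₀ t₁ : ℝ) : Prop :=
  (P.τ j = 0 → (γ t₀).1 ∈ P.vis j ∧ t₁ = t₀) ∧
  (P.τ j ≠ 0 → ∃ (c : ℂ) (ρ α o : ℝ), P.IsDwellCircle j c ρ ∧ (o = 1 ∨ o = -1) ∧
    t₁ = t₀ + P.τ j * (2 * Real.pi * ρ) / P.s ∧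
    ∀ t ∈ Set.Icc t₀ t₁,
      (γ t).1 = c + ρ * Complex.exp ((α + o * P.s * (t - t₀) / ρ : ℝ) * Complex.I) ∧
      ((γ t).2 : ℂ) =
        o * Complex.I * Complex.exp ((α + o * P.s * (t - t₀) / ρ : ℝ) * Complex.I))

/-- Feasible solutions of the continuous problem. The initial maneuver is a Dubins trajectory from
`v₀` to the starting point of the closed trajectory and takes time at most `ε`; the closed
trajectory is a closed Dubins trajectory along which dwell-time maneuvers are performed, one after
the other in some order `σ`, at all targets, beginning with the one at the first target. The
maneuver at the `k`-th target takes place during `[start k, finish k]`, and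
`start (Fin.last M) = closedTime` is the time of return. -/
def IsFeasible (T : Tour) : Prop :=
  0 ≤ T.initTime ∧ T.initTime ≤ P.ε ∧ P.IsDubinsOn T.init 0 T.initTime ∧
  T.init 0 = P.v₀ ∧ T.init T.initTime = T.closed 0 ∧
  0 ≤ T.closedTime ∧ P.IsDubinsOn T.closed 0 T.closedTime ∧ T.closed T.closedTime = T.closed 0 ∧
  ∃ (σ : Equiv.Perm (Fin M)) (start : Fin (M + 1) → ℝ) (finish : Fin M → ℝ),
    start 0 = 0 ∧ start (Fin.last M) = T.closedTime ∧
    ∀ k : Fin M, P.IsDwellManeuver (σ k) T.closed (start k.castSucc) (finish k) ∧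
      finish k ≤ start k.succ

/-- Optimal solutions of the continuous problem: feasible, with minimal closed trajectory time. -/
def IsOptimal (T : Tour) : Prop :=
  P.IsFeasible T ∧ ∀ T' : Tour, P.IsFeasible T' → T.closedTime ≤ T'.closedTime

/-- `INL_ε`, the initial maneuver set. -/
def inl : Set Config :=
  {v | (∃ j, v ∈ P.dwl j) ∧ P.dubinsDist P.v₀ v ≤ P.ε}

/-- The part of the closed trajectory set `CLS_ε` that belongs to the order `σ`, i.e.
`(DWL_{σ 0} ∩ INL_ε) × DWL_{σ 1} × ⋯`; `CLS_ε` is the union over `σ`. -/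
def cls [NeZero M] (σ : Equiv.Perm (Fin M)) : Set (Fin M → Config) :=
  {v | (∀ k, v k ∈ P.dwl (σ k)) ∧ v 0 ∈ P.inl}

/-- `LGTH`: the time of the closed trajectory through `v 0, v 1, …` (and back to `v 0`) that visits
the targets in the order `σ`. Addition in `Fin M` is cyclic. -/
def lgth [NeZero M] (σ : Equiv.Perm (Fin M)) (v : Fin M → Config) : ℝ :=
  ∑ k, (P.dwellTime (σ k) (v k) + P.dubinsDist (v k) (v (k + 1)))

/-- `LGTH*`, the infimum of `LGTH` over `CLS_ε`. -/
def lgthStar [NeZero M] : ℝ :=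
  sInf {l | ∃ σ, ∃ v ∈ P.cls σ, l = P.lgth σ v}

/-- Degeneracy. For every sequence in the closed trajectory set whose lengths tend to `LGTH*` and
which has a limit `w`: (i) `w` is not in the closed trajectory set, or (ii) `LGTH` is discontinuous
at `w`, or (iii) the first component of `w` is isolated in `INL_ε`, or (iv) that component is not a
limit of interior points of `INL_ε ∩ DWL` relative to `DWL`, where `DWL` is the dwell set of the
first target. -/
def IsDegenerate [NeZero M] : Prop :=
  ∀ (σ : Equiv.Perm (Fin M)) (v : ℕ → Fin M → Config) (w : Fin M → Config),
    (∀ n, v n ∈ P.cls σ) →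
    Tendsto (fun n => P.lgth σ (v n)) atTop (𝓝 P.lgthStar) →
    Tendsto v atTop (𝓝 w) →
      w ∉ P.cls σ ∨
      ¬ ContinuousWithinAt (P.lgth σ) (P.cls σ) w ∨
      ¬ AccPt (w 0) (𝓟 P.inl) ∨
      w 0 ∉ closure {u | u ∈ P.dwl (σ 0) ∧ P.inl ∈ 𝓝[P.dwl (σ 0)] u}

/-- A node of the graph: a sampled configuration together with its target. -/
abbrev Node (M : ℕ) : Type := Fin M × Config

/-- The node set `V` obtained from the sampled sets `A j ⊆ DWL_j`. -/
def nodes (A : Fin M → Finset Config) : Set (Node M) :=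
  {n | n.2 ∈ A n.1}

/-- The weight `W` of the edge from `n` to `n'`. -/
def weight (n n' : Node M) : ℝ :=
  P.dwellTime n.1 n.2 + P.dubinsDist n.2 n'.2

/-- The discrete set `INL_ε`, i.e. the nodes with `W(v₀, n) ≤ ε`. -/
def discreteInl (V : Set (Node M)) : Set (Node M) :=
  {n | n ∈ V ∧ P.dubinsDist P.v₀ n.2 ≤ P.ε}

/-- The nodes `𝒱` of the subgraph on which the GTSP is posed: the nodes of target `j` that are not
in `I` are removed. -/
def gtspNodes (V : Set (Node M)) (j : Fin M) (I : Set (Node M)) : Set (Node M) :=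
  V \ {n | n.1 = j ∧ n ∉ I}

/-- `g` is a closed path in the complete graph on `W` that visits exactly one node of each target,
written as a cyclic sequence of `M` nodes. -/
def IsGtspTour (W : Set (Node M)) (g : Fin M → Node M) : Prop :=
  (∀ k, g k ∈ W) ∧ Function.Bijective (fun k => (g k).1)

/-- The weight of a closed path. -/
def gtspCost [NeZero M] (g : Fin M → Node M) : ℝ :=
  ∑ k, P.weight (g k) (g (k + 1))

/-- `g` is an optimal solution of the GTSP on `W`. -/
def IsGtspOptimal [NeZero M] (W : Set (Node M)) (g : Fin M → Node M) : Prop :=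
  IsGtspTour W g ∧ ∀ g', IsGtspTour W g' → P.gtspCost g ≤ P.gtspCost g'

/-- `u` is the closed path `g`, cyclically permuted so that it begins at target `j`. -/
def IsCyclicShift [NeZero M] (j : Fin M) (g u : Fin M → Node M) : Prop :=
  (∃ i : Fin M, ∀ k, u k = g (k + i)) ∧ (u 0).1 = j

/-- The tour `T` is obtained from the node sequence `u` by concatenating optimal Dubins paths
through `v₀, u 0, …, u (M - 1), u 0` and inserting the dwell-time maneuver of each node `u k`,
which takes place during `[start k, finish k]`. -/
def IsRouteOf [NeZero M] (u : Fin M → Node M) (T : Tour) : Prop :=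
  P.IsOptimalPath T.init 0 T.initTime P.v₀ (u 0).2 ∧
  ∃ (start : Fin (M + 1) → ℝ) (finish : Fin M → ℝ),
    start 0 = 0 ∧ start (Fin.last M) = T.closedTime ∧
    ∀ k : Fin M,
      T.closed (start k.castSucc) = (u k).2 ∧
      P.IsDwellManeuver (u k).1 T.closed (start k.castSucc) (finish k) ∧
      P.IsOptimalPath T.closed (finish k) (start k.succ) (u k).2 (u (k + 1)).2

/-- `out` is a possible result of the complete heuristic on the sampled sets `A`; `none` is the
message that the discrete approximation is infeasible. The set `I` (`INL_ε^*` in the algorithm) is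
any set of nodes of the discrete `INL_ε` of a single target `j`, and any GTSP solver may be used. -/
def IsOutput [NeZero M] (A : Fin M → Finset Config) (out : Option Tour) : Prop :=
  (P.discreteInl (nodes A) = ∅ ∧ out = none) ∨
  ((P.discreteInl (nodes A)).Nonempty ∧
    ∃ (j : Fin M) (I : Set (Node M)) (g u : Fin M → Node M) (T : Tour),
      I ⊆ P.discreteInl (nodes A) ∧ (∀ n ∈ I, n.1 = j) ∧
      IsGtspTour (gtspNodes (nodes A) j I) g ∧ IsCyclicShift j g u ∧
      P.IsRouteOf u T ∧ out = some T)

/-- As `IsOutput`, when the GTSP is solved to optimality and, whenever the discrete `INL_ε` is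
non-empty, `I` consists of all its nodes of a target `j` such that either all nodes of the discrete
`INL_ε` belong to `j` or all nodes of `j` lie in the discrete `INL_ε`. -/
def IsExactOutput [NeZero M] (A : Fin M → Finset Config) (out : Option Tour) : Prop :=
  (P.discreteInl (nodes A) = ∅ ∧ out = none) ∨
  ((P.discreteInl (nodes A)).Nonempty ∧
    ∃ (j : Fin M) (I : Set (Node M)) (g u : Fin M → Node M) (T : Tour),
      (P.discreteInl (nodes A) ⊆ {n | n.1 = j} ∨
        {n | n ∈ nodes A ∧ n.1 = j} ⊆ P.discreteInl (nodes A)) ∧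
      I = {n | n ∈ P.discreteInl (nodes A) ∧ n.1 = j} ∧
      P.IsGtspOptimal (gtspNodes (nodes A) j I) g ∧ IsCyclicShift j g u ∧
      P.IsRouteOf u T ∧ out = some T)

end Mission

/-- `A N` is a sample of `N` points of `S`, for every `N`. -/
def IsSampling (S : Set Config) (A : ℕ → Finset Config) : Prop :=
  ∀ N, (A N : Set Config) ⊆ S ∧ (A N).card = N

/-- Dense sampling procedures. -/
def IsDenseSampling (S : Set Config) (A : ℕ → Finset Config) : Prop :=
  IsSampling S A ∧
  ∀ x ∈ S, ∀ U : Set Config, IsOpen U → x ∈ U →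
    ∃ N₀ : ℕ, ∀ N > N₀, ((A N : Set Config) ∩ U).Nonempty

end

/-!
The length of the closed trajectory through dwell configurations `v 0, v 1, …` in the order `σ` is
`LGTH σ v`, so the proof compares the minimization of `LGTH` with the continuous problem on one side
and with the GTSP on the other.

* Continuous problem. Cutting a feasible tour at the starts of its dwell-time maneuvers yields an
  element of the closed trajectory set that is at most as long
  (`Mission.IsFeasible.exists_lgth_le`). Conversely, dwell-time maneuvers and optimal Dubins paths
  can be concatenated (`Mission.exists_isRouteOf`) to a feasible tour
  (`Mission.IsRouteOf.isFeasible`) whose duration is exactly `LGTH`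
  (`Mission.IsRouteOf.closedTime_eq`). This uses that the infimum in `DIST` is attained
  (`Mission.reach_dubinsDist`). Any two configurations are joined by a left turn, a segment and a
  left turn (`Mission.exists_reach`), and the possible travel times form a closed set, because the
  heading angles, which determine the trajectory, are equi-Lipschitz and hence form a compact set
  by the Arzelà–Ascoli theorem (`Mission.isCompact_headings`).
* GTSP. Non-degeneracy provides a minimizer `w` of `LGTH` at which `LGTH` is continuous and whose
  first component is a limit of relative interior points of the initial maneuver set
  (`Mission.exists_minimizer_of_not_isDegenerate`). By density the samples eventually contain a
  closed trajectory near `w` that starts in the initial maneuver set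
  (`Mission.eventually_exists_sampled_cls`). It survives the deletion of nodes, so an optimal GTSP
  solution is at most as long (`Mission.IsExactOutput.closedTime_le`).

The durations of the outputs are therefore eventually below any bound above `LGTH*`, and they are at
least `LGTH*` because the outputs are feasible tours.
-/

open Filter Topology

noncomputable section

namespace Mission

variable {M : ℕ} {P : Mission M}

/-! ### Dubins trajectories -/

theorem IsDubinsOn.mono {γ : ℝ → Config} {a b c d : ℝ} (h : P.IsDubinsOn γ a b)
    (hs : Set.Icc c d ⊆ Set.Icc a b) : P.IsDubinsOn γ c d := by
  obtain ⟨Θ, h1, h2⟩ := h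
  exact ⟨Θ, fun t ht t' ht' => h1 t (hs ht) t' (hs ht'),
    fun t ht => ⟨(h2 t (hs ht)).1, (h2 t (hs ht)).2.mono hs⟩⟩

theorem IsDubinsOn.congr {γ γ' : ℝ → Config} {a b : ℝ} (h : P.IsDubinsOn γ a b)
    (he : ∀ t ∈ Set.Icc a b, γ' t = γ t) : P.IsDubinsOn γ' a b := by
  obtain ⟨Θ, h1, h2⟩ := h
  refine ⟨Θ, h1, fun t ht => ?_⟩
  rw [he t ht]
  exact ⟨(h2 t ht).1, (h2 t ht).2.congr (fun x hx => by rw [he x hx]) (by rw [he t ht])⟩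

theorem IsDubinsOn.shift {γ : ℝ → Config} {a b : ℝ} (h : P.IsDubinsOn γ a b) (c : ℝ) :
    P.IsDubinsOn (fun t => γ (t - c)) (a + c) (b + c) := by
  obtain ⟨Θ, h1, h2⟩ := h
  have hm : ∀ t ∈ Set.Icc (a + c) (b + c), t - c ∈ Set.Icc a b := fun t ht =>
    ⟨by linarith [ht.1], by linarith [ht.2]⟩
  refine ⟨fun t => Θ (t - c), fun t ht t' ht' => ?_, fun t ht => ⟨(h2 _ (hm t ht)).1, ?_⟩⟩
  · have := h1 _ (hm t ht) _ (hm t' ht')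
    rwa [sub_sub_sub_cancel_right] at this
  · have := (h2 _ (hm t ht)).2
    have h3 : HasDerivWithinAt (fun t : ℝ => t - c) 1 (Set.Icc (a + c) (b + c)) t :=
      ((hasDerivAt_id t).sub_const c).hasDerivWithinAt
    simpa [Function.comp_def] using HasDerivWithinAt.scomp t this h3 (fun x hx => hm x hx)

/-- Concatenation. The two heading lifts differ at the junction by a multiple of `2π`, by which the
second one is corrected. -/
theorem IsDubinsOn.trans {γ : ℝ → Config} {a b c : ℝ} (hab : a ≤ b) (hbc : b ≤ c)
    (h : P.IsDubinsOn γ a b) (h' : P.IsDubinsOn γ b c) : P.IsDubinsOn γ a c := by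
  obtain ⟨Θ, h1, h2⟩ := h
  obtain ⟨Θ', h1', h2'⟩ := h'
  have hb : b ∈ Set.Icc a b := ⟨hab, le_rfl⟩
  have hb' : b ∈ Set.Icc b c := ⟨le_rfl, hbc⟩
  obtain ⟨m, hm⟩ := Circle.exp_eq_exp.1 ((h2 b hb).1.symm.trans (h2' b hb').1)
  refine ⟨fun t => if t ≤ b then Θ t else Θ' t + m * (2 * Real.pi), ?_, ?_⟩
  · -- By symmetry, only `t ≤ t'` has to be considered.
    have key : ∀ t ∈ Set.Icc a c, ∀ t' ∈ Set.Icc a c, t ≤ t' →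
        |(if t ≤ b then Θ t else Θ' t + m * (2 * Real.pi)) -
          (if t' ≤ b then Θ t' else Θ' t' + m * (2 * Real.pi))| ≤ P.s / P.r * |t - t'| := by
      intro t ht t' ht' htt
      split_ifs with h3 h4 h4
      · exact h1 t ⟨ht.1, h3⟩ t' ⟨ht'.1, h4⟩
      · have e1 := h1 t ⟨ht.1, h3⟩ b hb
        have e2 := h1' b hb' t' ⟨(not_le.1 h4).le, ht'.2⟩
        have e3 : Θ t - (Θ' t' + m * (2 * Real.pi)) = (Θ t - Θ b) + (Θ' b - Θ' t') := by
          rw [hm]; ring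
        rw [e3]
        refine (abs_add_le _ _).trans ((add_le_add e1 e2).trans (le_of_eq ?_))
        rw [abs_of_nonpos (by linarith), abs_of_nonpos (by linarith [not_le.1 h4]),
          abs_of_nonpos (by linarith)]
        ring
      · exact absurd (htt.trans h4) h3
      · have := h1' t ⟨(not_le.1 h3).le, ht.2⟩ t' ⟨(not_le.1 h4).le, ht'.2⟩
        rwa [add_sub_add_right_eq_sub]
    intro t ht t' ht'
    rcases le_total t t' with h3 | h3
    · exact key t ht t' ht' h3
    · rw [abs_sub_comm, abs_sub_comm t]
      exact key t' ht' t ht h3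
  · intro t ht
    refine ⟨?_, ?_⟩
    · beta_reduce
      split_ifs with h3
      · exact (h2 t ⟨ht.1, h3⟩).1
      · rw [(h2' t ⟨(not_le.1 h3).le, ht.2⟩).1]
        exact Circle.exp_eq_exp.2 ⟨-m, by push_cast; ring⟩
    · -- Outside a closed interval, the derivative within it is unconstrained.
      rw [← Set.Icc_union_Icc_eq_Icc hab hbc]
      have hout : ∀ {x y : ℝ}, t ∉ Set.Icc x y →
          HasDerivWithinAt (fun t' => (γ t').1) (P.s * ((γ t).2 : ℂ)) (Set.Icc x y) t :=
        fun hx => HasFDerivWithinAt.of_notMem_closure (by rwa [isClosed_Icc.closure_eq])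
      refine HasDerivWithinAt.union ?_ ?_
      · by_cases h3 : t ∈ Set.Icc a b
        · exact (h2 t h3).2
        · exact hout h3
      · by_cases h3 : t ∈ Set.Icc b c
        · exact (h2' t h3).2
        · exact hout h3

theorem isDubinsOn_self (γ : ℝ → Config) (a : ℝ) : P.IsDubinsOn γ a a := by
  refine ⟨fun _ => ((γ a).2 : ℂ).arg, fun t _ t' _ => ?_, fun t ht => ?_⟩
  · simpa using mul_nonneg (div_pos P.s_pos P.r_pos).le (abs_nonneg (t - t'))
  · have : t = a := by simpa using ht
    subst this
    refine ⟨(Circle.exp_arg _).symm, ?_⟩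
    rw [Set.Icc_self]
    exact HasFDerivWithinAt.of_subsingleton Set.subsingleton_singleton

/-- Uniform motion along a circle of radius `ρ ≥ r`, counter-clockwise for `o = 1` and clockwise
for `o = -1`. The heading has the angle of the radius, turned by `o * π / 2`. -/
theorem isDubinsOn_of_circle {γ : ℝ → Config} {t₀ t₁ ρ α o : ℝ} {c : ℂ} (hρ : P.r ≤ ρ)
    (ho : o = 1 ∨ o = -1)
    (h : ∀ t ∈ Set.Icc t₀ t₁,
      (γ t).1 = c + ρ * Complex.exp ((α + o * P.s * (t - t₀) / ρ : ℝ) * Complex.I) ∧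
      ((γ t).2 : ℂ) =
        o * Complex.I * Complex.exp ((α + o * P.s * (t - t₀) / ρ : ℝ) * Complex.I)) :
    P.IsDubinsOn γ t₀ t₁ := by
  have hρ0 : 0 < ρ := P.r_pos.trans_le hρ
  have hs := P.s_pos
  have hr := P.r_pos
  refine ⟨fun t => (α + o * P.s * (t - t₀) / ρ) + o * (Real.pi / 2), fun t _ t' _ => ?_,
    fun t ht => ⟨?_, ?_⟩⟩
  · have e : (α + o * P.s * (t - t₀) / ρ) + o * (Real.pi / 2) -
        ((α + o * P.s * (t' - t₀) / ρ) + o * (Real.pi / 2)) = o * (P.s / ρ * (t - t')) := by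
      field_simp; ring
    have ho' : |o| = 1 := by rcases ho with rfl | rfl <;> simp
    rw [e, abs_mul, ho', one_mul, abs_mul, abs_of_pos (div_pos hs hρ0)]
    gcongr
  · have hquarter : Complex.exp ((o * (Real.pi / 2) : ℝ) * Complex.I) = o * Complex.I := by
      rcases ho with rfl | rfl
      · simp [Complex.exp_pi_div_two_mul_I]
      · rw [show ((-1 * (Real.pi / 2) : ℝ) : ℂ) * Complex.I = -Real.pi / 2 * Complex.I by
          push_cast; ring, Complex.exp_neg_pi_div_two_mul_I]
        simp
    apply Circle.ext
    beta_reduce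
    rw [(h t ht).2, Circle.coe_exp, Complex.ofReal_add _ (o * _), add_mul, Complex.exp_add,
      mul_comm, hquarter]
  · have hd : HasDerivAt (fun t : ℝ =>
        c + ρ * Complex.exp ((α + o * P.s * (t - t₀) / ρ : ℝ) * Complex.I))
        (P.s * ((γ t).2 : ℂ)) t := by
      rw [(h t ht).2]
      have h1 : HasDerivAt (fun t : ℝ => α + o * P.s * (t - t₀) / ρ) (o * P.s / ρ) t := by
        have := ((((hasDerivAt_id t).sub_const t₀).const_mul (o * P.s)).div_const ρ).const_add α
        simpa using this
      have h2 := (((h1.ofReal_comp.mul_const Complex.I).cexp).const_mul (ρ : ℂ)).const_add c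
      refine h2.congr_deriv ?_
      have : (ρ : ℂ) ≠ 0 := by exact_mod_cast hρ0.ne'
      rw [Complex.ofReal_div (o * P.s), Complex.ofReal_mul o]
      field_simp
    exact hd.hasDerivWithinAt.congr (fun x hx => (h x hx).1) (h t ht).1

/-! ### Existence of Dubins paths -/

variable (P)

/-- Some Dubins path leads from `v` to `w` in time `T`. -/
def Reach (T : ℝ) (v w : Config) : Prop :=
  0 ≤ T ∧ ∃ γ : ℝ → Config, P.IsDubinsOn γ 0 T ∧ γ 0 = v ∧ γ T = w

variable {P}

theorem IsDubinsOn.reach {γ : ℝ → Config} {a b : ℝ} (h : P.IsDubinsOn γ a b) (hab : a ≤ b) :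
    P.Reach (b - a) (γ a) (γ b) := by
  refine ⟨sub_nonneg.2 hab, fun t => γ (t - -a), ?_, by simp, by simp⟩
  simpa [sub_eq_add_neg] using h.shift (-a)

theorem Reach.trans {T T' : ℝ} {u v w : Config} (h : P.Reach T u v) (h' : P.Reach T' v w) :
    P.Reach (T + T') u w := by
  obtain ⟨hT, γ, hγ, rfl, rfl⟩ := h
  obtain ⟨hT', γ', hγ', h0, rfl⟩ := h'
  have hc : ∀ t ∈ Set.Icc T (T + T'),
      (if t ≤ T then γ t else γ' (t - T)) = γ' (t - T) := by
    intro t ht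
    split_ifs with h3
    · rw [le_antisymm h3 ht.1, sub_self, h0]
    · rfl
  refine ⟨add_nonneg hT hT', fun t => if t ≤ T then γ t else γ' (t - T), ?_, by simp [hT], ?_⟩
  · refine IsDubinsOn.trans (b := T) hT (by linarith) (hγ.congr fun t ht => if_pos ht.2) ?_
    refine IsDubinsOn.congr ?_ hc
    simpa [add_comm] using hγ'.shift T
  · simpa using hc (T + T') ⟨by linarith, le_rfl⟩

theorem Reach.dubinsDist_le {T : ℝ} {v w : Config} (h : P.Reach T v w) : P.dubinsDist v w ≤ T :=
  csInf_le ⟨0, fun _ hx => hx.1⟩ h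

variable (P)

theorem dubinsDist_nonneg (v w : Config) : 0 ≤ P.dubinsDist v w :=
  Real.sInf_nonneg fun _ hx => hx.1

theorem reach_straight (x : ℂ) (h : Circle) {ℓ : ℝ} (hℓ : 0 ≤ ℓ) :
    P.Reach (ℓ / P.s) (x, h) (x + ℓ * h, h) := by
  have hs := P.s_pos
  refine ⟨div_nonneg hℓ hs.le, fun t => (x + (P.s * t : ℝ) * h, h),
    ⟨fun _ => (h : ℂ).arg, fun t _ t' _ => ?_, fun t _ => ⟨(Circle.exp_arg _).symm, ?_⟩⟩,
    by simp, ?_⟩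
  · simpa using mul_nonneg (div_pos P.s_pos P.r_pos).le (abs_nonneg (t - t'))
  · have h1 : HasDerivAt (fun t : ℝ => P.s * t) P.s t := by
      simpa using (hasDerivAt_id t).const_mul P.s
    exact ((h1.ofReal_comp.mul_const (h : ℂ)).const_add x).hasDerivWithinAt
  · beta_reduce
    rw [mul_div_cancel₀ _ hs.ne']

/-- A left turn of radius `r` about `c` can change the heading arbitrarily. -/
theorem exists_reach_left_turn (c : ℂ) (h h' : Circle) :
    ∃ T, P.Reach T (c - Complex.I * P.r * h, h) (c - Complex.I * P.r * h', h') := by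
  have hs := P.s_pos
  have hr := P.r_pos
  set θ : ℝ := (h : ℂ).arg
  set δ : ℝ := ((h' / h : Circle) : ℂ).arg + 2 * Real.pi with hδ
  have hδ0 : 0 ≤ δ := by
    have := Complex.neg_pi_lt_arg ((h' / h : Circle) : ℂ)
    have := Real.pi_pos
    linarith
  have hexp : ∀ φ : ℝ, Complex.exp ((θ - Real.pi / 2 + φ : ℝ) * Complex.I) =
      -Complex.I * (h * Circle.exp φ : Circle) := by
    intro φ
    have e : ((θ - Real.pi / 2 + φ : ℝ) : ℂ) * Complex.I =
      -Real.pi / 2 * Complex.I + (θ : ℂ) * Complex.I + (φ : ℂ) * Complex.I := by push_cast; ring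
    rw [e, Complex.exp_add, Complex.exp_add, Complex.exp_neg_pi_div_two_mul_I, mul_assoc]
    rw [← Circle.coe_exp, ← Circle.coe_exp, Circle.exp_arg, Circle.coe_mul]
  refine ⟨P.r * δ / P.s, by positivity,
    fun t => (c - Complex.I * P.r * (h * Circle.exp (P.s * t / P.r) : Circle),
      h * Circle.exp (P.s * t / P.r)), ?_, by simp, ?_⟩
  · refine isDubinsOn_of_circle (ρ := P.r) (α := θ - Real.pi / 2) (o := 1) (c := c) le_rfl
      (Or.inl rfl) fun t _ => ?_
    rw [one_mul, sub_zero, hexp]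
    refine ⟨by ring, ?_⟩
    rw [Complex.ofReal_one, one_mul, ← mul_assoc]
    simp
  · have e1 : P.s * (P.r * δ / P.s) / P.r = δ := by field_simp
    have e2 : h * Circle.exp δ = h' := by
      rw [hδ, Circle.exp_add, Circle.exp_arg, Circle.exp_two_pi, mul_one, mul_div_cancel]
    simp only [e1, e2]

/-- Any two configurations are joined by a Dubins path: a left turn, a segment parallel to the line
through the centres of the two left-turn circles, and another left turn. -/
theorem exists_reach (v w : Config) : ∃ T, P.Reach T v w := by
  obtain ⟨x, h⟩ := v
  obtain ⟨y, k⟩ := w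
  set c : ℂ := x + Complex.I * P.r * h with hc
  set c' : ℂ := y + Complex.I * P.r * k with hc'
  set d : Circle := Circle.exp (c' - c).arg with hd
  have hcc : c + ‖c' - c‖ * d = c' := by
    rw [hd, Circle.coe_exp, Complex.norm_mul_exp_arg_mul_I]
    ring
  obtain ⟨T₁, h₁⟩ := P.exists_reach_left_turn c h d
  have h₂ := P.reach_straight (c - Complex.I * P.r * d) d (norm_nonneg (c' - c))
  obtain ⟨T₃, h₃⟩ := P.exists_reach_left_turn c' d k
  rw [show c - Complex.I * P.r * d + ‖c' - c‖ * d = c' - Complex.I * P.r * d by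
    linear_combination hcc] at h₂
  have h₄ := (h₁.trans h₂).trans h₃
  rw [show c - Complex.I * P.r * h = x by rw [hc]; ring,
    show c' - Complex.I * P.r * k = y by rw [hc']; ring] at h₄
  exact ⟨_, h₄⟩

/-! ### Existence of optimal Dubins paths -/

/-- The Lipschitz constant of the heading angle. -/
def turnRate : NNReal := ⟨P.s / P.r, (div_pos P.s_pos P.r_pos).le⟩

/-- The heading angles of all infinite Dubins trajectories whose initial heading angle is `θ`. -/
def headings (θ : ℝ) : Set C(ℝ, ℝ) := {f | LipschitzWith P.turnRate f ∧ f 0 = θ}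

/-- The configuration at time `p.2` on the Dubins trajectory from `x` with heading angle `p.1`. -/
def steer (x : ℂ) (p : C(ℝ, ℝ) × ℝ) : Config :=
  (x + P.s * ∫ u in (0 : ℝ)..p.2, (Circle.exp (p.1 u) : ℂ), Circle.exp (p.1 p.2))

theorem continuous_steer (x : ℂ) : Continuous (P.steer x) := by
  have h0 : Continuous fun p : C(ℝ, ℝ) × ℝ => p.1 p.2 := by fun_prop
  have h1 : Continuous (Function.uncurry fun (f : C(ℝ, ℝ)) (u : ℝ) => (Circle.exp (f u) : ℂ)) :=
    continuous_subtype_val.comp (Circle.exp.continuous.comp h0)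
  have h2 := intervalIntegral.continuous_parametric_primitive_of_continuous
    (μ := MeasureTheory.volume) (a₀ := 0) h1
  exact (continuous_const.add (continuous_const.mul h2)).prodMk (Circle.exp.continuous.comp h0)

/-- By the Arzelà–Ascoli theorem, the heading angles form a compact set. -/
theorem isCompact_headings (θ : ℝ) : IsCompact (P.headings θ) := by
  apply ArzelaAscoli.isCompact_of_equicontinuous
  · have hb : IsCompact (Set.univ.pi fun t : ℝ =>
        Metric.closedBall θ (P.turnRate * dist t 0)) :=
      isCompact_univ_pi fun t => isCompact_closedBall _ _
    have himg : ContinuousMap.toFun '' P.headings θ =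
        {g : ℝ → ℝ | (∀ t t', dist (g t) (g t') ≤ P.turnRate * dist t t') ∧ g 0 = θ} := by
      ext g
      constructor
      · rintro ⟨f, ⟨hf, hf0⟩, rfl⟩
        exact ⟨fun t t' => hf.dist_le_mul t t', hf0⟩
      · rintro ⟨hg, hg0⟩
        have hL := LipschitzWith.of_dist_le_mul hg
        exact ⟨⟨g, hL.continuous⟩, ⟨hL, hg0⟩, rfl⟩
    rw [himg]
    refine hb.of_isClosed_subset ?_ ?_
    · have hint : {g : ℝ → ℝ | ∀ t t', dist (g t) (g t') ≤ P.turnRate * dist t t'} =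
          ⋂ t, ⋂ t', {g | dist (g t) (g t') ≤ P.turnRate * dist t t'} := by
        ext g
        simp
      refine IsClosed.inter ?_ (isClosed_eq (continuous_apply 0) continuous_const)
      change IsClosed {g : ℝ → ℝ | ∀ t t', dist (g t) (g t') ≤ P.turnRate * dist t t'}
      rw [hint]
      exact isClosed_iInter fun t => isClosed_iInter fun t' =>
        isClosed_le ((continuous_apply t).dist (continuous_apply t')) continuous_const
    · rintro g ⟨hg, hg0⟩ t -
      rw [Metric.mem_closedBall, ← hg0]
      exact hg t 0
  · exact (LipschitzWith.uniformEquicontinuous (fun f : P.headings θ => (f : ℝ → ℝ)) P.turnRate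
      fun f => f.2.1).equicontinuous

variable {P}

theorem isDubinsOn_steer {x : ℂ} {θ : ℝ} {f : C(ℝ, ℝ)} (hf : f ∈ P.headings θ) (a b : ℝ) :
    P.IsDubinsOn (fun t => P.steer x (f, t)) a b := by
  refine ⟨f, fun t _ t' _ => hf.1.dist_le_mul t t', fun t _ => ⟨rfl, ?_⟩⟩
  have hcont : Continuous fun u : ℝ => (Circle.exp (f u) : ℂ) :=
    continuous_subtype_val.comp (Circle.exp.continuous.comp f.continuous)
  exact (((hcont.integral_hasStrictDerivAt 0 t).hasDerivAt.const_mul (P.s : ℂ)).const_add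
    x).hasDerivWithinAt

/-- A Dubins trajectory is determined by its initial location and its heading angle, and the latter
may be taken to start at the principal argument and to be Lipschitz on all of `ℝ`. -/
theorem IsDubinsOn.exists_steer {γ : ℝ → Config} {T : ℝ} (hT : 0 ≤ T)
    (h : P.IsDubinsOn γ 0 T) :
    ∃ f ∈ P.headings ((γ 0).2 : ℂ).arg, P.steer (γ 0).1 (f, T) = γ T := by
  obtain ⟨Θ, h1, h2⟩ := h
  have h0T : (0 : ℝ) ∈ Set.Icc 0 T := ⟨le_rfl, hT⟩
  have hTT : T ∈ Set.Icc 0 T := ⟨hT, le_rfl⟩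
  obtain ⟨m, hm⟩ := Circle.exp_eq_exp.1 ((h2 0 h0T).1.symm.trans (Circle.exp_arg (γ 0).2).symm)
  have hΘ : LipschitzOnWith P.turnRate (fun t => Θ t - m * (2 * Real.pi)) (Set.Icc 0 T) := by
    refine LipschitzOnWith.of_dist_le_mul fun t ht t' ht' => ?_
    rw [dist_sub_right]
    exact h1 t ht t' ht'
  obtain ⟨g, hg, hgΘ⟩ := hΘ.extend_real
  let f : C(ℝ, ℝ) := ⟨g, hg.continuous⟩
  have hf : ∀ t ∈ Set.Icc 0 T, (γ t).2 = Circle.exp (f t) := by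
    intro t ht
    rw [(h2 t ht).1]
    exact Circle.exp_eq_exp.2 ⟨m, by rw [show f t = _ from (hgΘ ht).symm]; ring⟩
  refine ⟨f, ⟨hg, ?_⟩, Prod.ext ?_ (hf T hTT).symm⟩
  · rw [show f 0 = Θ 0 - m * (2 * Real.pi) from (hgΘ h0T).symm, hm]
    ring
  · have hcont : Continuous fun u : ℝ => (P.s : ℂ) * (Circle.exp (f u) : ℂ) :=
      continuous_const.mul
        (continuous_subtype_val.comp (Circle.exp.continuous.comp f.continuous))
    have := intervalIntegral.integral_eq_sub_of_hasDerivAt_of_le (f := fun t => (γ t).1)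
      (f' := fun u => (P.s : ℂ) * (Circle.exp (f u) : ℂ)) hT
      (fun t ht => (h2 t ht).2.continuousWithinAt)
      (fun t ht => by
        have := (h2 t (Set.Ioo_subset_Icc_self ht)).2
        rw [hf t (Set.Ioo_subset_Icc_self ht)] at this
        exact this.hasDerivAt (Icc_mem_nhds ht.1 ht.2))
      (hcont.intervalIntegrable _ _)
    rw [intervalIntegral.integral_const_mul] at this
    simp only [steer, this]
    ring

variable (P)

/-- The minimum in the definition of `dubinsDist` is attained: the possible travel times form a
closed set, as the projection of a closed set along the compact set of heading angles. -/
theorem reach_dubinsDist (v w : Config) : P.Reach (P.dubinsDist v w) v w := by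
  have hset : {T : ℝ | P.Reach T v w} = Set.Ici 0 ∩
      Prod.snd '' {p : P.headings (v.2 : ℂ).arg × ℝ | P.steer v.1 (p.1, p.2) = w} := by
    ext T
    constructor
    · rintro ⟨hT, γ, hγ, rfl, rfl⟩
      obtain ⟨f, hf, hfT⟩ := hγ.exists_steer hT
      exact ⟨hT, ⟨(⟨f, hf⟩, T), hfT, rfl⟩⟩
    · rintro ⟨hT, ⟨⟨f, hf⟩, T'⟩, hfT, rfl⟩
      refine ⟨hT, fun t => P.steer v.1 (f, t), isDubinsOn_steer hf _ _, ?_, hfT⟩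
      simp [steer, hf.2]
  have hclosed : IsClosed {T : ℝ | P.Reach T v w} := by
    rw [hset]
    have : CompactSpace (P.headings (v.2 : ℂ).arg) :=
      isCompact_iff_compactSpace.1 (P.isCompact_headings _)
    refine isClosed_Ici.inter (isClosedMap_snd_of_compactSpace _ (isClosed_eq ?_ continuous_const))
    exact (P.continuous_steer v.1).comp
      ((continuous_subtype_val.comp continuous_fst).prodMk continuous_snd)
  exact hclosed.csInf_mem (P.exists_reach v w) ⟨0, fun _ hx => hx.1⟩

theorem exists_isOptimalPath (v w : Config) (t : ℝ) :
    ∃ γ, P.IsOptimalPath γ t (t + P.dubinsDist v w) v w := by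
  obtain ⟨h0, γ, hγ, rfl, hw⟩ := P.reach_dubinsDist v w
  refine ⟨fun t' => γ (t' - t), by linarith, ?_, by simp, by simpa using hw, by ring⟩
  simpa [add_comm] using hγ.shift t

/-! ### Dwell-time maneuvers -/

variable {P}

theorem IsDwellCircle.r_le {j : Fin M} {c : ℂ} {ρ : ℝ} (h : P.IsDwellCircle j c ρ) : P.r ≤ ρ := by
  by_cases hb : P.beh j = Behavior.full
  · exact (h.1 hb).2
  · exact (h.2.1 hb).2.ge

theorem IsDwellCircle.dwellTime_eq {j : Fin M} {c : ℂ} {ρ : ℝ} (h : P.IsDwellCircle j c ρ)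
    {v : Config} (hv : ‖v.1 - c‖ = ρ) :
    P.dwellTime j v = P.τ j * (2 * Real.pi * ρ) / P.s := by
  unfold dwellTime
  split
  · next hb => rw [← (h.1 hb).1, hv]
  · next hb => rw [(h.2.1 hb).2]

theorem dwellTime_of_τ_eq_zero {j : Fin M} (h : P.τ j = 0) (v : Config) : P.dwellTime j v = 0 := by
  unfold dwellTime
  split <;> simp [h]

theorem dwellTime_nonneg (j : Fin M) (v : Config) : 0 ≤ P.dwellTime j v := by
  have := P.r_pos
  have := P.s_pos
  have := Real.pi_pos
  unfold dwellTime
  split <;> positivity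

/-- A dwell-time maneuver is a closed Dubins trajectory that starts in the dwell set and takes the
time `dwellTime`. -/
theorem IsDwellManeuver.properties {j : Fin M} {γ : ℝ → Config} {t₀ t₁ : ℝ}
    (h : P.IsDwellManeuver j γ t₀ t₁) :
    γ t₀ ∈ P.dwl j ∧ t₁ = t₀ + P.dwellTime j (γ t₀) ∧ γ t₁ = γ t₀ ∧ P.IsDubinsOn γ t₀ t₁ := by
  by_cases hτ : P.τ j = 0
  · obtain ⟨h1, rfl⟩ := h.1 hτ
    exact ⟨⟨fun _ => h1, fun h' => absurd hτ h'⟩, by rw [dwellTime_of_τ_eq_zero hτ, add_zero], rfl,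
      isDubinsOn_self _ _⟩
  · obtain ⟨c, ρ, α, o, hc, ho, ht, hγ⟩ := h.2 hτ
    have hρ : 0 < ρ := P.r_pos.trans_le hc.r_le
    have hs := P.s_pos
    have hle : t₀ ≤ t₁ := by
      have : 0 ≤ P.τ j * (2 * Real.pi * ρ) / P.s := by
        have := Real.pi_pos
        positivity
      linarith
    have h0 := hγ t₀ ⟨le_rfl, hle⟩
    have h1 := hγ t₁ ⟨hle, le_rfl⟩
    have hperiod : Complex.exp ((α + o * P.s * (t₁ - t₀) / ρ : ℝ) * Complex.I) =
        Complex.exp ((α + o * P.s * (t₀ - t₀) / ρ : ℝ) * Complex.I) := by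
      rw [← Circle.coe_exp, ← Circle.coe_exp]
      refine congrArg (fun z : Circle => (z : ℂ)) ?_
      have e : α + o * P.s * (t₁ - t₀) / ρ = α + o * (P.τ j * (2 * Real.pi)) := by
        rw [ht]; field_simp; ring
      rw [e, Circle.exp_eq_exp]
      rcases ho with rfl | rfl
      · exact ⟨P.τ j, by simp⟩
      · exact ⟨-P.τ j, by push_cast; ring⟩
    have hclosed : γ t₁ = γ t₀ :=
      Prod.ext (by rw [h0.1, h1.1, hperiod]) (Circle.ext (by rw [h0.2, h1.2, hperiod]))
    have hnorm : ‖(γ t₀).1 - c‖ = ρ := by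
      rw [h0.1, add_sub_cancel_left, norm_mul, Complex.norm_exp_ofReal_mul_I, mul_one,
        Complex.norm_of_nonneg hρ.le]
    refine ⟨⟨fun h' => absurd h' hτ, fun _ => ⟨c, ρ, hc, by simpa using hnorm, ?_⟩⟩,
      by rw [hc.dwellTime_eq hnorm, ht], hclosed, isDubinsOn_of_circle hc.r_le ho hγ⟩
    rw [h0.1, h0.2, add_sub_cancel_left, Complex.inner]
    generalize Complex.exp ((α + o * P.s * (t₀ - t₀) / ρ : ℝ) * Complex.I) = E
    have e : o * Complex.I * E * (starRingEnd ℂ) (ρ * E) =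
        ((ρ * o * Complex.normSq E : ℝ) : ℂ) * Complex.I := by
      rw [map_mul, Complex.conj_ofReal]
      push_cast
      rw [Complex.normSq_eq_conj_mul_self]
      ring
    rw [e, Complex.re_ofReal_mul, Complex.I_re, mul_zero]

theorem IsDwellManeuver.le {j : Fin M} {γ : ℝ → Config} {t₀ t₁ : ℝ}
    (h : P.IsDwellManeuver j γ t₀ t₁) : t₀ ≤ t₁ := by
  rw [h.properties.2.1]
  exact le_add_of_nonneg_right (dwellTime_nonneg _ _)

theorem IsDwellManeuver.congr {j : Fin M} {γ γ' : ℝ → Config} {t₀ t₁ : ℝ}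
    (h : P.IsDwellManeuver j γ t₀ t₁) (he : ∀ t ∈ Set.Icc t₀ t₁, γ' t = γ t) :
    P.IsDwellManeuver j γ' t₀ t₁ := by
  refine ⟨fun hτ => ?_, fun hτ => ?_⟩
  · rw [he t₀ ⟨le_rfl, h.le⟩]
    exact h.1 hτ
  · obtain ⟨c, ρ, α, o, hc, ho, ht, hγ⟩ := h.2 hτ
    exact ⟨c, ρ, α, o, hc, ho, ht, fun t ht => by rw [he t ht]; exact hγ t ht⟩

/-- A unit vector orthogonal to `z ≠ 0` is obtained from the direction of `z` by a quarter turn. -/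
theorem exists_eq_quarter_turn {z : ℂ} (hz : z ≠ 0) {h : Circle} (hzh : inner ℝ z (h : ℂ) = 0) :
    ∃ o : ℝ, (o = 1 ∨ o = -1) ∧ (h : ℂ) = o * Complex.I * Complex.exp (z.arg * Complex.I) := by
  set E : ℂ := Complex.exp (z.arg * Complex.I) with hE
  have hzE : z = ‖z‖ * E := (Complex.norm_mul_exp_arg_mul_I z).symm
  have hnE : ‖E‖ = 1 := Complex.norm_exp_ofReal_mul_I _
  have hEE : E * (starRingEnd ℂ) E = 1 := by
    rw [Complex.mul_conj, Complex.normSq_eq_norm_sq, hnE]; simp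
  have hn : ‖z‖ ≠ 0 := norm_ne_zero_iff.2 hz
  have hre : (h * (starRingEnd ℂ) E).re = 0 := by
    rw [hzE, Complex.inner, map_mul, Complex.conj_ofReal, mul_left_comm,
      Complex.re_ofReal_mul] at hzh
    exact (mul_eq_zero.1 hzh).resolve_left hn
  set q : ℂ := h * (starRingEnd ℂ) E with hq
  have hqn : ‖q‖ = 1 := by rw [hq, norm_mul, RCLike.norm_conj, hnE, Circle.norm_coe, one_mul]
  have hqI : q = q.im * Complex.I := by
    apply Complex.ext <;> simp [hre]
  refine ⟨q.im, ?_, ?_⟩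
  · rw [hqI, norm_mul, Complex.norm_I, mul_one, Complex.norm_real, Real.norm_eq_abs] at hqn
    exact eq_or_eq_neg_of_abs_eq (by simpa using hqn)
  · rw [← hqI, hq, mul_assoc, mul_comm _ E, hEE, mul_one]

variable (P)

theorem exists_isDwellManeuver {j : Fin M} {v : Config} (hv : v ∈ P.dwl j) (t₀ : ℝ) :
    ∃ γ, γ t₀ = v ∧ P.IsDwellManeuver j γ t₀ (t₀ + P.dwellTime j v) := by
  by_cases hτ : P.τ j = 0
  · refine ⟨fun _ => v, rfl, fun _ => ⟨hv.1 hτ, ?_⟩, fun h => absurd hτ h⟩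
    rw [dwellTime_of_τ_eq_zero hτ, add_zero]
  · obtain ⟨c, ρ, hc, hvc, hin⟩ := hv.2 hτ
    have hρ : 0 < ρ := P.r_pos.trans_le hc.r_le
    have hnorm : ‖v.1 - c‖ = ρ := by simpa using hvc
    have hne : v.1 - c ≠ 0 := norm_ne_zero_iff.1 (by rw [hnorm]; exact hρ.ne')
    obtain ⟨o, ho, hvo⟩ := exists_eq_quarter_turn hne hin
    set α := (v.1 - c).arg
    have hhead : ∀ t : ℝ, ((v.2 * Circle.exp (o * P.s * (t - t₀) / ρ) : Circle) : ℂ) =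
        o * Complex.I * Complex.exp ((α + o * P.s * (t - t₀) / ρ : ℝ) * Complex.I) := by
      intro t
      rw [Circle.coe_mul, hvo, Circle.coe_exp, Complex.ofReal_add, add_mul, Complex.exp_add]
      ring
    refine ⟨fun t => (c + ρ * Complex.exp ((α + o * P.s * (t - t₀) / ρ : ℝ) * Complex.I),
      v.2 * Circle.exp (o * P.s * (t - t₀) / ρ)), ?_, fun h => absurd h hτ, fun _ =>
      ⟨c, ρ, α, o, hc, ho, by rw [hc.dwellTime_eq hnorm], fun t _ => ⟨rfl, hhead t⟩⟩⟩
    refine Prod.ext ?_ (by simp)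
    have := Complex.norm_mul_exp_arg_mul_I (v.1 - c)
    rw [hnorm] at this
    simp [α, this]

/-! ### Routes through a sequence of nodes -/

variable {P}

theorem IsOptimalPath.congr {γ γ' : ℝ → Config} {t₀ t₁ : ℝ} {v w : Config}
    (h : P.IsOptimalPath γ t₀ t₁ v w) (he : ∀ t ∈ Set.Icc t₀ t₁, γ' t = γ t) :
    P.IsOptimalPath γ' t₀ t₁ v w := by
  obtain ⟨h1, h2, h3, h4, h5⟩ := h
  exact ⟨h1, h2.congr he, by rw [he _ ⟨le_rfl, h1⟩, h3], by rw [he _ ⟨h1, le_rfl⟩, h4], h5⟩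

theorem weight_nonneg (n n' : Node M) : 0 ≤ P.weight n n' :=
  add_nonneg (dwellTime_nonneg _ _) (P.dubinsDist_nonneg _ _)

/-- The index after `k` is either the cyclic successor, or the last one, after which the cycle
starts again. -/
theorem succ_eq_or_last [NeZero M] (k : Fin M) :
    (k + 1).castSucc = k.succ ∨ (k.succ = Fin.last M ∧ k + 1 = 0) := by
  obtain _ | n := M
  · exact k.elim0
  · induction k using Fin.lastCases with
    | last => exact Or.inr ⟨rfl, Fin.last_add_one n⟩
    | cast i => exact Or.inl (by rw [Fin.coeSucc_eq_succ]; rfl)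

theorem sum_succ_sub_castSucc : ∀ {n : ℕ} (f : Fin (n + 1) → ℝ),
    ∑ k : Fin n, (f k.succ - f k.castSucc) = f (Fin.last n) - f 0
  | 0, f => by simp
  | n + 1, f => by
    have h := sum_succ_sub_castSucc (fun k : Fin (n + 1) => f k.castSucc)
    rw [Fin.sum_univ_castSucc]
    simp only [Fin.succ_castSucc, Fin.succ_last, h, Fin.castSucc_zero]
    ring

theorem IsRouteOf.closedTime_eq [NeZero M] {u : Fin M → Node M} {T : Tour}
    (h : P.IsRouteOf u T) : T.closedTime = P.gtspCost u := by
  obtain ⟨-, start, finish, h0, hlast, hk⟩ := h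
  rw [← hlast, ← sub_zero (start _), ← h0, ← sum_succ_sub_castSucc, gtspCost]
  refine Finset.sum_congr rfl fun k _ => ?_
  obtain ⟨hs, hd, hp⟩ := hk k
  have h1 := hd.properties.2.1
  have h2 := hp.2.2.2.2
  rw [hs] at h1
  rw [weight]
  linarith

/-- Dwell-time maneuvers and optimal paths are Dubins trajectories that fit
together, so a route is a feasible tour once its initial maneuver is short enough. -/
theorem IsRouteOf.isFeasible [NeZero M] {u : Fin M → Node M} {T : Tour}
    (h : P.IsRouteOf u T) (hu : Function.Bijective fun k => (u k).1)
    (hε : P.dubinsDist P.v₀ (u 0).2 ≤ P.ε) : P.IsFeasible T := by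
  obtain ⟨⟨hi0, hiD, hi1, hi2, hi3⟩, start, finish, h0, hlast, hk⟩ := h
  rw [sub_zero] at hi3
  have hstart : T.closed 0 = (u 0).2 := by
    rw [← (hk 0).1, Fin.castSucc_zero', h0]
  have key : ∀ k, 0 ≤ start k ∧ P.IsDubinsOn T.closed 0 (start k) := by
    intro k
    induction k using Fin.induction with
    | zero => rw [h0]; exact ⟨le_rfl, isDubinsOn_self _ _⟩
    | succ k ih =>
      obtain ⟨hs, hd, hp⟩ := hk k
      exact ⟨ih.1.trans (hd.le.trans hp.1), (ih.2.trans ih.1 hd.le hd.properties.2.2.2).trans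
        (ih.1.trans hd.le) hp.1 hp.2.1⟩
  have hend : T.closed T.closedTime = T.closed 0 := by
    obtain ⟨k, hk1⟩ : ∃ k : Fin M, k + 1 = 0 := ⟨0 - 1, sub_add_cancel _ _⟩
    have hk2 : k.succ = Fin.last M := by
      rcases succ_eq_or_last k with h | h
      · rw [hk1, Fin.castSucc_zero'] at h
        exact absurd h.symm (Fin.succ_ne_zero k)
      · exact h.1
    have := (hk k).2.2.2.2.2.1
    rwa [hk2, hlast, hk1, ← hstart] at this
  refine ⟨hi0, hi3.trans_le hε, hiD, hi1, hi2.trans hstart.symm, ?_, ?_, hend,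
    Equiv.ofBijective _ hu, start, finish, h0, hlast, fun k => ⟨(hk k).2.1, (hk k).2.2.1⟩⟩
  · rw [← hlast]; exact (key _).1
  · rw [← hlast]; exact (key _).2

/-- Every feasible tour takes at least the time `LGTH` of the starting points of its dwell-time
maneuvers. -/
theorem IsFeasible.exists_lgth_le [NeZero M] {T : Tour} (h : P.IsFeasible T) :
    ∃ σ, ∃ v ∈ P.cls σ, P.lgth σ v ≤ T.closedTime := by
  obtain ⟨hi0, hiε, hiD, hi1, hi2, hc0, hcD, hc1, σ, start, finish, h0, hlast, hk⟩ := h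
  have hmono : Monotone start :=
    Fin.monotone_iff_le_succ.2 fun k => (hk k).1.le.trans (hk k).2
  have hmem : ∀ k, 0 ≤ start k ∧ start k ≤ T.closedTime := fun k =>
    ⟨h0.symm.le.trans (hmono (Fin.zero_le k)), (hmono (Fin.le_last k)).trans hlast.le⟩
  have hnext : ∀ k : Fin M, T.closed (start k.succ) = T.closed (start (k + 1).castSucc) := by
    intro k
    rcases succ_eq_or_last k with h | ⟨h, h'⟩
    · rw [h]
    · rw [h, h', hlast, hc1, Fin.castSucc_zero', h0]
  have hdwl : ∀ k : Fin M, T.closed (start k.castSucc) ∈ P.dwl (σ k) := fun k =>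
    (hk k).1.properties.1
  refine ⟨σ, fun k => T.closed (start k.castSucc), ⟨hdwl, ⟨σ 0, hdwl 0⟩, ?_⟩, ?_⟩
  · beta_reduce
    rw [Fin.castSucc_zero', h0, ← hi1, ← hi2]
    exact (hiD.reach hi0).dubinsDist_le.trans (by rwa [sub_zero])
  · rw [← hlast, ← sub_zero (start _), ← h0, ← sum_succ_sub_castSucc, lgth]
    refine Finset.sum_le_sum fun k _ => ?_
    obtain ⟨-, h2, h3, -⟩ := (hk k).1.properties
    have hD : P.IsDubinsOn T.closed (finish k) (start k.succ) :=
      hcD.mono (Set.Icc_subset_Icc ((hmem _).1.trans (hk k).1.le) (hmem _).2)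
    have h4 := (hD.reach (hk k).2).dubinsDist_le
    rw [h3, hnext] at h4
    linarith

variable (P)

theorem exists_leg {n : Node M} (hn : n.2 ∈ P.dwl n.1) (n' : Node M) (t : ℝ) :
    ∃ γ, γ t = n.2 ∧ P.IsDwellManeuver n.1 γ t (t + P.dwellTime n.1 n.2) ∧
      P.IsOptimalPath γ (t + P.dwellTime n.1 n.2) (t + P.weight n n') n.2 n'.2 := by
  obtain ⟨γ, h0, hγ⟩ := P.exists_isDwellManeuver hn t
  obtain ⟨γ', hγ'⟩ := P.exists_isOptimalPath n.2 n'.2 (t + P.dwellTime n.1 n.2)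
  rw [add_assoc] at hγ'
  set t' := t + P.dwellTime n.1 n.2
  refine ⟨fun x => if x ≤ t' then γ x else γ' x, ?_, ?_, ?_⟩
  · exact (if_pos hγ.le).trans h0
  · exact hγ.congr fun x hx => if_pos hx.2
  · refine hγ'.congr fun x hx => ?_
    by_cases hx' : x ≤ t'
    · obtain rfl : x = t' := le_antisymm hx' hx.1
      rw [if_pos le_rfl, hγ'.2.2.1, hγ.properties.2.2.1, h0]
    · exact if_neg hx'

/-- Finitely many functions on consecutive intervals that agree at the junctions are the
restrictions of a single function. -/
theorem exists_glue {α : Type*} {t : ℕ → ℝ} (ht : Monotone t) (p : ℕ → ℝ → α)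
    (hp : ∀ k, p k (t (k + 1)) = p (k + 1) (t (k + 1))) (n : ℕ) :
    ∃ γ : ℝ → α, γ (t n) = p n (t n) ∧
      ∀ k < n, ∀ x ∈ Set.Icc (t k) (t (k + 1)), γ x = p k x := by
  induction n with
  | zero => exact ⟨p 0, rfl, fun k hk => absurd hk (Nat.not_lt_zero k)⟩
  | succ n ih =>
    obtain ⟨γ, h1, h2⟩ := ih
    have hn : ∀ x, t n ≤ x → (if x ≤ t n then γ x else p n x) = p n x := by
      intro x hx
      split_ifs with h
      · rw [le_antisymm h hx, h1]
      · rfl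
    refine ⟨fun x => if x ≤ t n then γ x else p n x, ?_, fun k hk x hx => ?_⟩
    · exact (hn _ (ht n.le_succ)).trans (hp n)
    · rcases Nat.lt_succ_iff_lt_or_eq.1 hk with h | rfl
      · exact (if_pos (hx.2.trans (ht h))).trans (h2 k h x hx)
      · exact hn x hx.1

theorem exists_isRouteOf [NeZero M] {u : Fin M → Node M} (hu : ∀ k, (u k).2 ∈ P.dwl (u k).1) :
    ∃ T, P.IsRouteOf u T := by
  -- The nodes are enumerated periodically by the natural numbers.
  let n : ℕ → Node M := fun i => u (Fin.ofNat M i)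
  let t : ℕ → ℝ := fun i => ∑ l ∈ Finset.range i, P.weight (n l) (n (l + 1))
  have hstep : ∀ i, t (i + 1) = t i + P.weight (n i) (n (i + 1)) := fun i =>
    Finset.sum_range_succ _ _
  have ht : Monotone t := monotone_nat_of_le_succ fun i => by
    rw [hstep]; exact le_add_of_nonneg_right (weight_nonneg _ _)
  choose p hp0 hpd hpo using fun i => P.exists_leg (hu (Fin.ofNat M i)) (n (i + 1)) (t i)
  have hpo' : ∀ i, P.IsOptimalPath (p i) (t i + P.dwellTime (n i).1 (n i).2) (t (i + 1))
      (n i).2 (n (i + 1)).2 := fun i => by rw [hstep]; exact hpo i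
  obtain ⟨γ, -, hγ⟩ := exists_glue ht p
    (fun i => (hpo' i).2.2.2.1.trans (hp0 (i + 1)).symm) M
  obtain ⟨γ₀, hγ₀⟩ := P.exists_isOptimalPath P.v₀ (u 0).2 0
  rw [zero_add] at hγ₀
  have hval : ∀ k : Fin M, Fin.ofNat M (k : ℕ) = k := fun k => Fin.ofNat_val_eq_self k
  have hnext : ∀ k : Fin M, Fin.ofNat M ((k : ℕ) + 1) = k + 1 := fun k => by
    apply Fin.ext
    simp [Fin.val_add]
  refine ⟨⟨_, γ₀, t M, γ⟩, hγ₀, fun k => t k, fun k => t k + P.dwellTime (u k).1 (u k).2, ?_, ?_,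
    fun k => ?_⟩
  · simp [t]
  · simp
  · have h1 := hp0 k
    have h2 := hpd k
    have h3 := hpo' k
    simp only [n, hval, hnext] at h1 h2 h3
    simp only [Fin.val_castSucc, Fin.val_succ]
    have heq := hγ k k.2
    refine ⟨?_, h2.congr fun x hx => heq x ⟨hx.1, hx.2.trans h3.1⟩,
      h3.congr fun x hx => heq x ⟨h2.le.trans hx.1, hx.2⟩⟩
    rw [heq _ ⟨le_rfl, ht (Nat.le_succ _)⟩, h1]

/-! ### Outputs of the algorithm -/

variable {P}

theorem IsOutput.isFeasible [NeZero M] {A : Fin M → Finset Config} {T : Tour}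
    (h : P.IsOutput A (some T)) : P.IsFeasible T := by
  rcases h with ⟨-, h⟩ | ⟨-, j, I, g, u, T', hI, -, hg, ⟨⟨i, hi⟩, hj⟩, hT, h⟩
  · cases h
  · cases h
    refine hT.isFeasible ?_ ?_
    · have : (fun k => (u k).1) = (fun k => (g k).1) ∘ Equiv.addRight i :=
        funext fun k => by simp [hi k]
      rw [this]
      exact hg.2.comp (Equiv.bijective _)
    · have h0 : u 0 ∈ gtspNodes (nodes A) j I := by rw [hi]; exact hg.1 _
      have : u 0 ∈ I := by
        by_contra hI'
        exact h0.2 ⟨hj, hI'⟩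
      exact (hI this).2

theorem IsExactOutput.isOutput [NeZero M] {A : Fin M → Finset Config} {out : Option Tour}
    (h : P.IsExactOutput A out) : P.IsOutput A out := by
  rcases h with h | ⟨hne, j, I, g, u, T, -, rfl, hg, hs, hT, h⟩
  · exact Or.inl h
  · exact Or.inr ⟨hne, j, _, g, u, T, fun n hn => hn.1, fun n hn => hn.2, hg.1, hs, hT, h⟩

theorem IsCyclicShift.gtspCost_eq [NeZero M] {j : Fin M} {g u : Fin M → Node M}
    (h : IsCyclicShift j g u) : P.gtspCost u = P.gtspCost g := by
  obtain ⟨⟨i, hi⟩, -⟩ := h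
  refine Fintype.sum_equiv (Equiv.addRight i) _ _ fun k => ?_
  rw [hi, hi, Equiv.coe_addRight, add_right_comm]

/-- An exact output is at most as long as any closed trajectory through sampled configurations that
starts in the initial maneuver set. The choice of the target `j` ensures that such a trajectory
survives the deletion of nodes. -/
theorem IsExactOutput.closedTime_le [NeZero M] {A : Fin M → Finset Config} {out : Option Tour}
    (h : P.IsExactOutput A out) (σ : Equiv.Perm (Fin M)) (v : Fin M → Config)
    (hv : ∀ k, v k ∈ A (σ k)) (h0 : v 0 ∈ P.inl) :
    ∃ T, out = some T ∧ T.closedTime ≤ P.lgth σ v := by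
  have h0I : (σ 0, v 0) ∈ P.discreteInl (nodes A) := ⟨hv 0, h0.2⟩
  rcases h with ⟨h, -⟩ | ⟨-, j, I, g, u, T, hj, rfl, hg, hs, hT, rfl⟩
  · rw [h] at h0I
    exact absurd h0I (Set.notMem_empty _)
  · refine ⟨T, rfl, ?_⟩
    rw [hT.closedTime_eq, hs.gtspCost_eq]
    refine hg.2 (fun k => (σ k, v k)) ⟨fun k => ⟨hv k, ?_⟩, σ.bijective⟩
    rintro ⟨hkj, hkI⟩
    refine hkI ⟨?_, hkj⟩
    rcases hj with hj | hj
    · have hk0 : k = 0 := σ.injective (hkj.trans (hj h0I).symm)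
      rw [hk0]
      exact h0I
    · exact hj ⟨hv k, hkj⟩

theorem lgth_nonneg [NeZero M] (σ : Equiv.Perm (Fin M)) (v : Fin M → Config) : 0 ≤ P.lgth σ v :=
  Finset.sum_nonneg fun k _ => weight_nonneg (P := P) (σ k, v k) (σ (k + 1), v (k + 1))

theorem lgthStar_le [NeZero M] {σ : Equiv.Perm (Fin M)} {v : Fin M → Config} (hv : v ∈ P.cls σ) :
    P.lgthStar ≤ P.lgth σ v := by
  refine csInf_le ⟨0, ?_⟩ ⟨σ, v, hv, rfl⟩
  rintro _ ⟨σ', v', -, rfl⟩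
  exact lgth_nonneg _ _

theorem IsFeasible.lgthStar_le [NeZero M] {T : Tour} (h : P.IsFeasible T) :
    P.lgthStar ≤ T.closedTime := by
  obtain ⟨σ, v, hv, hle⟩ := h.exists_lgth_le
  exact (Mission.lgthStar_le hv).trans hle

theorem exists_isFeasible_of_mem_cls [NeZero M] {σ : Equiv.Perm (Fin M)} {w : Fin M → Config}
    (hw : w ∈ P.cls σ) : ∃ T, P.IsFeasible T ∧ T.closedTime = P.lgth σ w := by
  obtain ⟨T, hT⟩ := P.exists_isRouteOf (u := fun k => (σ k, w k)) hw.1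
  exact ⟨T, hT.isFeasible σ.bijective hw.2.2, hT.closedTime_eq⟩

/-- A non-degenerate problem has a minimizer of `LGTH` at which `LGTH` is continuous and whose first
component is a limit of relative interior points of the initial maneuver set. -/
theorem exists_minimizer_of_not_isDegenerate [NeZero M] (h : ¬ P.IsDegenerate) :
    ∃ σ, ∃ w ∈ P.cls σ, P.lgth σ w = P.lgthStar ∧ ContinuousWithinAt (P.lgth σ) (P.cls σ) w ∧
      w 0 ∈ closure {u | u ∈ P.dwl (σ 0) ∧ P.inl ∈ 𝓝[P.dwl (σ 0)] u} := by
  unfold IsDegenerate at h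
  push Not at h
  obtain ⟨σ, v, w, hv, hl, hvw, hw, hc, -, hcl⟩ := h
  refine ⟨σ, w, hw, ?_, hc, hcl⟩
  exact tendsto_nhds_unique
    (hc.tendsto.comp (tendsto_nhdsWithin_iff.2 ⟨hvw, Eventually.of_forall hv⟩)) hl

/-- Dense samples eventually meet every relatively open part of the initial maneuver set and every
neighbourhood of a dwell configuration, hence contain closed trajectories that are arbitrarily
close to a minimizer as above. -/
theorem eventually_exists_sampled_cls [NeZero M]
    {A : ℕ → Fin M → Finset Config} (hA : ∀ j, IsDenseSampling (P.dwl j) (fun N => A N j))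
    {σ : Equiv.Perm (Fin M)} {w : Fin M → Config} (hw : w ∈ P.cls σ)
    (hcl : w 0 ∈ closure {u | u ∈ P.dwl (σ 0) ∧ P.inl ∈ 𝓝[P.dwl (σ 0)] u})
    {s : Set (Fin M → Config)} (hs : s ∈ 𝓝[P.cls σ] w) :
    ∀ᶠ N in atTop, ∃ v ∈ s, (∀ k, v k ∈ A N (σ k)) ∧ v 0 ∈ P.inl := by
  obtain ⟨O, hO, hwO, hOs⟩ := mem_nhdsWithin.1 hs
  obtain ⟨U, hU, hUO⟩ := isOpen_pi_iff'.1 hO w hwO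
  obtain ⟨x, hxU, hx, hxI⟩ := mem_closure_iff.1 hcl (U 0) (hU 0).1 (hU 0).2
  obtain ⟨V, hV, hxV, hVI⟩ := mem_nhdsWithin.1 hxI
  have hdense : ∀ (j : Fin M) (y : Config), y ∈ P.dwl j → ∀ W : Set Config, IsOpen W → y ∈ W →
      ∀ᶠ N in atTop, ((A N j : Set Config) ∩ W).Nonempty := by
    intro j y hy W hW hyW
    obtain ⟨N₀, hN₀⟩ := (hA j).2 y hy W hW hyW
    filter_upwards [eventually_gt_atTop N₀] with N hN using hN₀ N hN
  have h0 := hdense (σ 0) x hx (U 0 ∩ V) ((hU 0).1.inter hV) ⟨hxU, hxV⟩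
  have hk : ∀ᶠ N in atTop, ∀ k, ((A N (σ k) : Set Config) ∩ U k).Nonempty :=
    eventually_all.2 fun k => hdense (σ k) (w k) (hw.1 k) (U k) (hU k).1 (hU k).2
  filter_upwards [h0, hk] with N ⟨y, hyA, hyU, hyV⟩ hN
  choose z hzA hzU using hN
  have hyI : y ∈ P.inl := hVI ⟨hyV, ((hA (σ 0)).1 N).1 hyA⟩
  have hv : ∀ k, Function.update z 0 y k ∈ (A N (σ k) : Set Config) ∩ U k := by
    intro k
    rcases eq_or_ne k 0 with rfl | hk
    · rw [Function.update_self]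
      exact ⟨hyA, hyU⟩
    · rw [Function.update_of_ne hk]
      exact ⟨hzA k, hzU k⟩
  have hv0 : Function.update z 0 y 0 ∈ P.inl := by rwa [Function.update_self]
  exact ⟨_, hOs ⟨hUO fun k _ => (hv k).2, fun k => ((hA (σ k)).1 N).1 (hv k).1, hv0⟩,
    fun k => (hv k).1, hv0⟩

end Mission

end

theorem mainTheorem2 {M : ℕ} [NeZero M] (P : Mission M)
    (hnd : ¬ P.IsDegenerate)
    (hne : P.inl.Nonempty)
    (hj : ∃ j : Fin M, P.inl ⊆ P.dwl j ∨ P.dwl j ⊆ P.inl) :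
    (∀ A : Fin M → Finset Config, (∀ j, (A j : Set Config) ⊆ P.dwl j) →
      ∀ T : Tour, P.IsOutput A (some T) → P.IsFeasible T) ∧
    (∀ A : ℕ → Fin M → Finset Config, (∀ j, IsDenseSampling (P.dwl j) (fun N => A N j)) →
      ∀ out : ℕ → Option Tour, (∀ N, P.IsExactOutput (A N) (out N)) →
      ∃ (Topt : Tour) (T : ℕ → Tour),
        P.IsOptimal Topt ∧
        (∀ᶠ N in Filter.atTop, out N = some (T N)) ∧
        Filter.Tendsto (fun N => (T N).closedTime) Filter.atTop (nhds Topt.closedTime)) := by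
  refine ⟨fun A _ T hT => hT.isFeasible, fun A hA out hout => ?_⟩
  obtain ⟨σ, w, hw, hstar, hcont, hcl⟩ := Mission.exists_minimizer_of_not_isDegenerate hnd
  obtain ⟨Topt, hfeas, htime⟩ := Mission.exists_isFeasible_of_mem_cls hw
  rw [hstar] at htime
  have hupper : ∀ b > P.lgthStar, ∀ᶠ N in Filter.atTop,
      ∃ T, out N = some T ∧ T.closedTime < b := by
    intro b hb
    have hs : {v | P.lgth σ v < b} ∈ nhdsWithin w (P.cls σ) :=
      hcont.eventually_lt_const (by rwa [hstar])
    filter_upwards [Mission.eventually_exists_sampled_cls hA hw hcl hs] with N hN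
    obtain ⟨v, hvb, hvA, hv0⟩ := hN
    obtain ⟨T, hT, hle⟩ := (hout N).closedTime_le σ v hvA hv0
    exact ⟨T, hT, hle.trans_lt hvb⟩
  -- `Topt` only fills in for the finitely many `N` without an output.
  have hsome : ∀ᶠ N in Filter.atTop, out N = some ((out N).getD Topt) :=
    (hupper _ (lt_add_one _)).mono fun N ⟨T, hT, _⟩ => by rw [hT]; rfl
  refine ⟨Topt, fun N => (out N).getD Topt, ⟨hfeas, fun T' hT' => ?_⟩, hsome, ?_⟩
  · rw [htime]
    exact hT'.lgthStar_le
  · rw [htime]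
    refine tendsto_order.2 ⟨fun b hb => ?_, fun b hb => ?_⟩
    · filter_upwards [hsome] with N hN
      have hout' := (hout N).isOutput
      rw [hN] at hout'
      exact hb.trans_le hout'.isFeasible.lgthStar_le
    · filter_upwards [hupper b hb] with N ⟨T, hT, hlt⟩
      rw [hT]
      exact hlt
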